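/- Let $n,m\ge 0$ and let $\mathcal X=\mathcal X_1\times\cdots\times\mathcal X_n$ and $\mathcal Y=\mathcal Y_1\times\cdots\times\mathcal Y_m$ with $\mathcal X_i=\{0,\dots,r_i-1\}$, $\mathcal Y_j=\{0,\dots,s_j-1\}$, $r_i,s_j\ge 1$. Let $A^{(\mathcal X)}$ be the real matrix with columns indexed by $\mathcal X$ whose $d_{\mathcal X}=1+\sum_{i}(|\mathcal X_i|-1)$ rows are the constant function $1$ and the indicator functions of $\{x\in\mathcal X: x_i=a\}$ for $i\in[n]$ and $a\in\mathcal X_i\setminus\{0\}$; define $A^{(\mathcal Y)}$ in the same way. Let $\mathcal E_{\mathcal X,\mathcal Y}$ be the exponential family of all probability distributions $p_\theta(x,y)=\frac1{Z(\theta)}\exp(\langle\theta,A_{(x,y)}\rangle)$ on $\mathcal X\times\mathcal Y$ with sufficient statistics matrix $A=A^{(\mathcal X)}\otimes A^{(\mathcal Y)}$ (Kronecker product) and arbitrary real parameter vector $\theta$, where $Z(\theta)$ is the normalization constant. The discrete restricted Boltzmann machine $\operatorname{RBM}_{\mathcal X,\mathcal Y}\subset\mathbb R^{\mathcal X}$ is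 the set of marginals on $\mathcal X$ of the distributions in $\mathcal E_{\mathcal X,\mathcal Y}$. These sets are semialgebraic, and $\dim$ denotes their dimension, taken as Hausdorff dimension. The Hamming ball of integer radius $\rho$ around $c\in\mathcal X$ is $\{x\in\mathcal X: |\{i: x_i\ne c_i\}|\le\rho\}$ (empty if $\rho<0$). A set $\mathcal Z\subseteq\mathcal X$ is called full rank if the matrix with columns $A^{(\mathcal X)}_x$, $x\in\mathcal Z$, has full row rank, that is, rank $d_{\mathcal X}$. 1. If $\mathcal X$ contains $m$ pairwise disjoint Hamming balls of radii $2(|\mathcal Y_j|-1)-1$, $j\in[m]$, such that the set of points of $\mathcal X$ not contained in any of these balls is full rank, then $$\dim(\operatorname{RBM}_{\mathcal X,\mathcal Y})=\Bigl(1+\sum_{i\in[n]}(|\mathcal X_i|-1)\Bigr)\Bigl(1+\sum_{j\in[m]}(|\mathcal Y_j|-1)\Bigr)-1,$$ and this is the dimension expected from counting parameters, $\min\{\dim(\mathcal E_{\mathcal X,\mathcal Y}),|\mathcal X|-1\}$. 2. If $|\mathcal Y_j|\ge 2$ for all $j\in[m]$ and $m$ Hamming balls of radius one cover $\mathcal X$,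 then $\dim(\operatorname{RBM}_{\mathcal X,\mathcal Y})=|\mathcal X|-1$. -/

import Mathlib

open scoped Kronecker

noncomputable section

namespace DiscreteRBM

/-- The joint states `𝒳 = 𝒳₁ × ⋯ × 𝒳ₙ`, where `𝒳ᵢ = {0, …, rᵢ - 1}`. -/
abbrev States {n : ℕ} (r : Fin n → ℕ) : Type := (i : Fin n) → Fin (r i)

/-- Index set of the sufficient statistics of the independence model: `none` stands for the
constant function one, `some ⟨i, a⟩` with `a ≠ 0` for the indicator of `{x | x i = a}`. -/
abbrev StatIdx {n : ℕ} (r : Fin n → ℕ) [∀ i, NeZero (r i)] : Type :=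
  Option (Σ i : Fin n, {a : Fin (r i) // a ≠ 0})

/-- The matrix `A^(𝒳)` of sufficient statistics of the independence model. -/
def suffStat {n : ℕ} (r : Fin n → ℕ) [∀ i, NeZero (r i)] :
    Matrix (StatIdx r) (States r) ℝ :=
  Matrix.of fun k x => match k with
    | none => 1
    | some ⟨i, a⟩ => if x i = a then 1 else 0

/-- The exponential family on a finite set `Ω` with sufficient statistics matrix `A`: all
probability distributions `ω ↦ exp ⟨θ, A_ω⟩ / Z(θ)`, as vectors in `ℝ^Ω`. -/
def expFamily {ι Ω : Type} [Fintype ι] [Fintype Ω] (A : Matrix ι Ω ℝ) : Set (Ω → ℝ) :=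
  Set.range fun (θ : ι → ℝ) (ω : Ω) =>
    Real.exp (∑ k, θ k * A k ω) / ∑ ω', Real.exp (∑ k, θ k * A k ω')

/-- The joint model `ℰ_{𝒳,𝒴}` of visible and hidden variables, whose sufficient statistics
matrix is the Kronecker product `A^(𝒳) ⊗ A^(𝒴)`. -/
def jointModel {n m : ℕ} (r : Fin n → ℕ) (s : Fin m → ℕ)
    [∀ i, NeZero (r i)] [∀ j, NeZero (s j)] : Set (States r × States s → ℝ) :=
  expFamily (suffStat r ⊗ₖ suffStat s)

/-- The discrete restricted Boltzmann machine `RBM_{𝒳,𝒴}`: the marginals on `𝒳` of the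
distributions in the joint model. -/
def RBM {n m : ℕ} (r : Fin n → ℕ) (s : Fin m → ℕ)
    [∀ i, NeZero (r i)] [∀ j, NeZero (s j)] : Set (States r → ℝ) :=
  (fun (p : States r × States s → ℝ) (x : States r) => ∑ y, p (x, y)) '' jointModel r s

/-- The (closed) Hamming ball around `c` with an integer radius; it is empty for a negative
radius. -/
def hammingBall {n : ℕ} {r : Fin n → ℕ} (c : States r) (ρ : ℤ) : Finset (States r) :=
  Finset.univ.filter fun x => (hammingDist x c : ℤ) ≤ ρ

/-- A set `Z` of joint states is full rank when the columns of `A^(𝒳)` indexed by `Z` form a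
matrix of full (row) rank, that is, of rank equal to the number of rows of `A^(𝒳)`. -/
def IsFullRank {n : ℕ} {r : Fin n → ℕ} [∀ i, NeZero (r i)] (Z : Finset (States r)) : Prop :=
  ((suffStat r).submatrix id (fun x : Z => (x : States r))).rank = Fintype.card (StatIdx r)

end DiscreteRBM

end

/-! ### Hausdorff dimension and rank of derivatives; low-temperature limits. -/

noncomputable section

namespace DiscreteRBM

open Filter Topology Module

/-! The upper bounds are soft: the machine is a linear image of an exponential family, whose
constant statistic is absorbed by normalization, and it lies in the hyperplane of coordinate sum
one.

The lower bounds are tropical. The Jacobian of the log marginal at `θ` averages the joint statistics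
over the posterior of the hidden state. Scaling `θ` to infinity concentrates the posterior on the
most likely state `h x`, so the Jacobian tends to `inferenceMatrix h`. Rank is lower semicontinuous,
so its rank is already attained at a finite parameter; normalization costs one
(`finrank_inference_le_dimH_marginal`). It remains to choose `h`.

For disjoint balls, the nonzero states of hidden unit `j` label pairs of consecutive spheres about
`c j`, and state `0` labels the outside. A kernel vector vanishes on its constant block by full rank
off the balls, then on each other block by `eq_zero_of_vanish_on_spheres`; so the rank is the number
of parameters. For covering balls, unit `j` detects ball `j`, on which point indicators are
combinations of statistics (`exists_mem_rowSpan_indicator`); so the range is everything. -/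

/-- The range of a map has at least the dimension of the range of any of its strict derivatives. -/
theorem finrank_range_le_dimH_range {E F : Type*} [NormedAddCommGroup E] [NormedSpace ℝ E]
    [CompleteSpace E] [NormedAddCommGroup F] [NormedSpace ℝ F] [FiniteDimensional ℝ F]
    {f : E → F} {f' : E →L[ℝ] F} {a : E} (hf : HasStrictFDerivAt f f' a) :
    (finrank ℝ (LinearMap.range (f' : E →ₗ[ℝ] F)) : ENNReal) ≤ dimH (Set.range f) := by
  set R := LinearMap.range (f' : E →ₗ[ℝ] F) with hR
  obtain ⟨p, hp⟩ := R.exists_isCompl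
  -- After projection onto its range the derivative is surjective, so the image contains an open
  -- set; the projection is Lipschitz and cannot raise dimension.
  let P : F →L[ℝ] R := LinearMap.toContinuousLinearMap (Submodule.projectionOnto R p hp)
  have hPf : HasStrictFDerivAt (fun x => P (f x)) (P.comp f') a :=
    P.hasStrictFDerivAt.comp a hf
  have hsurj : (P.comp f').range = ⊤ := by
    rw [LinearMap.range_eq_top]
    rintro ⟨y, x, rfl⟩
    exact ⟨x, Submodule.projectionOnto_apply_left hp ⟨f' x, x, rfl⟩⟩
  have hmem : Set.range (fun x => P (f x)) ∈ 𝓝 (P (f a)) := by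
    rw [← hPf.map_nhds_eq_of_surj hsurj]
    exact range_mem_map
  calc (finrank ℝ R : ENNReal) = dimH (Set.range fun x => P (f x)) :=
        (Real.dimH_of_mem_nhds hmem).symm
    _ = dimH (P '' Set.range f) := by rw [← Set.range_comp]; rfl
    _ ≤ dimH (Set.range f) := P.lipschitz.dimH_image_le _

/-- Softmax weights concentrate on the unique maximizer at low temperature. -/
theorem tendsto_softmax {Y : Type*} [Fintype Y] [DecidableEq Y] (u : Y → ℝ) (y₀ : Y)
    (h : ∀ y, y ≠ y₀ → u y < u y₀) (y : Y) :
    Tendsto (fun t : ℝ => Real.exp (t * u y) / ∑ y', Real.exp (t * u y')) atTop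
      (𝓝 (if y = y₀ then 1 else 0)) := by
  have key : ∀ y, Tendsto (fun t : ℝ => Real.exp (t * (u y - u y₀))) atTop
      (𝓝 (if y = y₀ then 1 else 0)) := by
    intro y
    split_ifs with hy
    · simp [hy]
    · refine Real.tendsto_exp_atBot.comp ?_
      exact tendsto_id.atTop_mul_const_of_neg (sub_neg.2 (h y hy))
  have hdiv := (key y).div (tendsto_finsetSum Finset.univ fun y' _ => key y') (by simp)
  simp only [Finset.sum_ite_eq', Finset.mem_univ, if_true, div_one] at hdiv
  -- Numerator and denominator were both divided by `exp (t * u y₀)`.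
  refine hdiv.congr fun t => ?_
  simp only [mul_sub, Real.exp_sub, ← Finset.sum_div]
  simp [div_div_div_cancel_right₀]

section LogMarginal

variable {E X Y : Type*} [NormedAddCommGroup E] [NormedSpace ℝ E] [Fintype X] [Fintype Y]

/-- The derivative of the logarithm of the unnormalized marginal: the conditional expectation of
the sufficient statistics. -/
def condMean [DecidableEq X] (a : X → Y → E →L[ℝ] ℝ) (θ : E) : E →L[ℝ] (X → ℝ) :=
  ∑ x, ∑ y, (Real.exp (a x y θ) / ∑ y', Real.exp (a x y' θ)) •
    (ContinuousLinearMap.single ℝ (fun _ : X => ℝ) x).comp (a x y)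

theorem hasStrictFDerivAt_logMarginal [DecidableEq X] [Nonempty Y] (a : X → Y → E →L[ℝ] ℝ)
    (θ : E) :
    HasStrictFDerivAt (fun θ x => Real.log (∑ y, Real.exp (a x y θ))) (condMean a θ) θ := by
  rw [hasStrictFDerivAt_pi']
  intro x
  have hpos : 0 < ∑ y, Real.exp (a x y θ) :=
    Finset.sum_pos (fun _ _ => Real.exp_pos _) Finset.univ_nonempty
  have h := (HasStrictFDerivAt.fun_sum (u := Finset.univ)
    fun y _ => (a x y).hasStrictFDerivAt.exp (x := θ)).log hpos.ne'
  have heq : (ContinuousLinearMap.proj x).comp (condMean a θ) =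
      (∑ y, Real.exp (a x y θ))⁻¹ • ∑ y, Real.exp (a x y θ) • a x y := by
    ext v
    simp [condMean, Pi.single_apply, Finset.mul_sum, div_eq_inv_mul, mul_assoc]
  rw [heq]
  exact h

theorem tendsto_condMean [DecidableEq X] (a : X → Y → E →L[ℝ] ℝ) (θ : E) (h : X → Y)
    (hh : ∀ x y, y ≠ h x → a x y θ < a x (h x) θ) :
    Tendsto (fun t : ℝ => condMean a (t • θ)) atTop
      (𝓝 (ContinuousLinearMap.pi fun x => a x (h x))) := by
  classical
  have := tendsto_finsetSum Finset.univ fun x _ => tendsto_finsetSum Finset.univ fun y _ =>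
    (tendsto_softmax (fun y => a x y θ) (h x) (hh x) y).smul_const
      ((ContinuousLinearMap.single ℝ (fun _ : X => ℝ) x).comp (a x y))
  convert this using 2
  · simp [condMean]
  · ext v x
    simp [Finset.sum_apply, Pi.single_apply]

/-- The dimension of the set of marginals is bounded below by the rank of the statistics selected
by an inference function `h`, minus one for the normalization. -/
theorem finrank_inference_le_dimH_marginal [FiniteDimensional ℝ E] [Nonempty X] [Nonempty Y]
    (a : X → Y → E →L[ℝ] ℝ) (θ : E) (h : X → Y)
    (hh : ∀ x y, y ≠ h x → a x y θ < a x (h x) θ) (K : ℕ)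
    (hK : K ≤ finrank ℝ (LinearMap.range
      (ContinuousLinearMap.pi fun x => a x (h x) : E →L[ℝ] (X → ℝ)).toLinearMap)) :
    ((K - 1 : ℕ) : ENNReal) ≤ dimH (Set.range fun (θ : E) (x : X) =>
      (∑ y, Real.exp (a x y θ)) / ∑ x, ∑ y, Real.exp (a x y θ)) := by
  classical
  obtain ⟨t, ht⟩ : ∃ t : ℝ,
      K ≤ finrank ℝ (LinearMap.range (condMean a (t • θ) : E →ₗ[ℝ] (X → ℝ))) := by
    -- Rank at least `K` is an open condition, so it passes from the limit to some finite `t`.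
    have hopen := isOpen_setOfPred_nat_le_rank (𝕜 := ℝ) (E := E)
      (F := X → ℝ) K
    have hev := (tendsto_condMean a θ h hh).eventually (hopen.eventually_mem (by
      simp only [Set.mem_ofPred_eq, LinearMap.rank, ← finrank_eq_rank]
      exact_mod_cast hK))
    obtain ⟨t, ht⟩ := hev.exists
    refine ⟨t, ?_⟩
    simp only [Set.mem_ofPred_eq, LinearMap.rank, ← finrank_eq_rank] at ht
    exact_mod_cast ht
  obtain ⟨x₀⟩ := ‹Nonempty X›
  -- Log ratios to `x₀` do not see the normalization; the kernel of `S` is the constants, so at most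
  -- one dimension is lost.
  let S : (X → ℝ) →L[ℝ] (X → ℝ) := ContinuousLinearMap.pi fun x =>
    ContinuousLinearMap.proj (R := ℝ) (φ := fun _ : X => ℝ) x -
      ContinuousLinearMap.proj (R := ℝ) (φ := fun _ : X => ℝ) x₀
  have hS : ∀ u x, S u x = u x - u x₀ := fun u x => rfl
  have hd := S.hasStrictFDerivAt.comp (t • θ) (hasStrictFDerivAt_logMarginal a (t • θ))
  have hrank : K ≤ finrank ℝ (LinearMap.range
      (S.comp (condMean a (t • θ)) : E →ₗ[ℝ] (X → ℝ))) + 1 := by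
    have hle : LinearMap.range (condMean a (t • θ) : E →ₗ[ℝ] (X → ℝ)) ≤
        LinearMap.range (S.comp (condMean a (t • θ)) : E →ₗ[ℝ] (X → ℝ)) ⊔
          Submodule.span ℝ {fun _ => 1} := by
      rintro _ ⟨v, rfl⟩
      refine Submodule.mem_sup.2 ⟨_, ⟨v, rfl⟩, condMean a (t • θ) v x₀ • fun _ => 1,
        Submodule.smul_mem _ _ (Submodule.mem_span_singleton_self _), ?_⟩
      ext x
      simp [hS]
    calc K ≤ _ := ht
      _ ≤ _ := Submodule.finrank_mono hle
      _ ≤ _ := Submodule.finrank_add_le_finrank_add_finrank _ _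
      _ ≤ _ := by
        gcongr
        exact (finrank_span_le_card _).trans (by simp)
  -- `g` is smooth on the positive orthant and takes normalized marginals to the same log ratios, so
  -- their dimension bounds that of the log ratios.
  let g : (X → ℝ) → (X → ℝ) := fun p x => Real.log (p x) - Real.log (p x₀)
  let s : Set (X → ℝ) := {p | ∀ x, 0 < p x}
  have hg : ContDiffOn ℝ 1 g s := by
    rw [contDiffOn_pi]
    intro x
    have hlog : ∀ x : X, ContDiffOn ℝ 1 (fun p : X → ℝ => Real.log (p x)) s := fun x =>
      ((contDiff_apply ℝ ℝ x).contDiffOn).log fun p hp => (hp x).ne'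
    exact (hlog x).sub (hlog x₀)
  have hs : Convex ℝ s := by
    have : s = Set.univ.pi fun _ => Set.Ioi (0 : ℝ) := by ext; simp [s]
    rw [this]
    exact convex_pi fun _ _ => convex_Ioi 0
  have hF : ∀ (θ : E) x, 0 < ∑ y, Real.exp (a x y θ) := fun θ x =>
    Finset.sum_pos (fun _ _ => Real.exp_pos _) Finset.univ_nonempty
  have hZ : ∀ θ : E, 0 < ∑ x, ∑ y, Real.exp (a x y θ) := fun θ =>
    Finset.sum_pos (fun x _ => hF θ x) ⟨x₀, Finset.mem_univ _⟩
  calc ((K - 1 : ℕ) : ENNReal) ≤ (finrank ℝ (LinearMap.range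
      (S.comp (condMean a (t • θ)) : E →ₗ[ℝ] (X → ℝ))) : ENNReal) := by
        exact_mod_cast Nat.sub_le_of_le_add hrank
    _ ≤ _ := finrank_range_le_dimH_range hd
    _ = dimH (g '' Set.range fun (θ : E) (x : X) =>
          (∑ y, Real.exp (a x y θ)) / ∑ x, ∑ y, Real.exp (a x y θ)) := by
        rw [← Set.range_comp]
        congr 2
        ext θ x
        simp only [Function.comp, hS, g]
        rw [Real.log_div (hF θ x).ne' (hZ θ).ne', Real.log_div (hF θ x₀).ne' (hZ θ).ne']
        ring
    _ ≤ _ := by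
        refine hg.dimH_image_le hs ?_
        rintro _ ⟨θ, rfl⟩ x
        exact div_pos (hF θ x) (hZ θ)

end LogMarginal

/-! ### Upper bounds on dimension. -/

/-- Vectors with coordinate sum one have dimension at most the number of coordinates minus one. -/
theorem dimH_le_of_sum_eq_one {X : Type*} [Fintype X] [Nonempty X] {T : Set (X → ℝ)}
    (hT : ∀ p ∈ T, ∑ x, p x = 1) : dimH T ≤ ((Fintype.card X - 1 : ℕ) : ENNReal) := by
  classical
  obtain ⟨x₀⟩ := ‹Nonempty X›
  let f : ({x // x ≠ x₀} → ℝ) → X → ℝ := fun u x => if h : x ≠ x₀ then u ⟨x, h⟩ else 1 - ∑ z, u z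
  have hf : ContDiff ℝ 1 f := by
    rw [contDiff_pi]
    intro x
    by_cases h : x ≠ x₀
    · simp only [f, h, ne_eq, not_false_eq_true, dite_true]
      exact contDiff_apply ℝ ℝ _
    · simp only [f, h, dite_false]
      exact contDiff_const.sub (ContDiff.sum fun z _ => contDiff_apply ℝ ℝ z)
  have hsub : T ⊆ Set.range f := by
    intro p hp
    refine ⟨fun z => p z, ?_⟩
    ext x
    by_cases h : x = x₀
    · subst h
      have hp1 := hT p hp
      rw [Fintype.sum_eq_add_sum_subtype_ne p x] at hp1
      simp only [f, ne_eq, not_true_eq_false, dite_false]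
      linarith
    · simp [f, h]
  calc dimH T ≤ dimH (Set.range f) := dimH_mono hsub
    _ ≤ _ := hf.dimH_range_le
    _ = _ := by simp [Fintype.card_subtype_compl]

/-- An exponential family one of whose statistics is constant has dimension at most the number of
the other statistics. -/
theorem dimH_expFamily_le {ι Ω : Type} [Fintype ι] [Fintype Ω] (A : Matrix ι Ω ℝ) (k₀ : ι)
    (hA : ∀ ω, A k₀ ω = 1) : dimH (expFamily A) ≤ ((Fintype.card ι - 1 : ℕ) : ENNReal) := by
  classical
  rcases isEmpty_or_nonempty Ω with hΩ | hΩ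
  · have := dimH_subsingleton (Set.subsingleton_of_subsingleton (s := expFamily A))
    simp [this]
  let e : ({k // k ≠ k₀} → ℝ) → Ω → ℝ := fun u ω => Real.exp (∑ k, u k * A k ω)
  let f : ({k // k ≠ k₀} → ℝ) → Ω → ℝ := fun u ω => e u ω / ∑ ω', e u ω'
  have he : ∀ ω, ContDiff ℝ 1 fun u => e u ω := fun ω =>
    (ContDiff.sum fun k _ => (contDiff_apply ℝ ℝ k).mul contDiff_const).exp
  have hf : ContDiff ℝ 1 f := by
    rw [contDiff_pi]
    intro ω
    refine (he ω).div (ContDiff.sum fun ω' _ => he ω') fun u => ?_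
    exact (Finset.sum_pos (fun _ _ => Real.exp_pos _) Finset.univ_nonempty).ne'
  -- The parameter of the constant statistic only contributes a factor that cancels against `Z(θ)`.
  have hsub : expFamily A ⊆ Set.range f := by
    rintro _ ⟨θ, rfl⟩
    refine ⟨fun k => θ k, ?_⟩
    ext ω
    simp only [f, e, Fintype.sum_eq_add_sum_subtype_ne _ k₀, hA, mul_one, Real.exp_add,
      ← Finset.mul_sum]
    rw [mul_div_mul_left _ _ (Real.exp_pos _).ne']
  calc dimH (expFamily A) ≤ dimH (Set.range f) := dimH_mono hsub
    _ ≤ _ := hf.dimH_range_le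
    _ = _ := by simp [Fintype.card_subtype_compl]

end DiscreteRBM

end

/-! ### Statistics of the independence model on Hamming balls and spheres. -/

noncomputable section

namespace DiscreteRBM

open Module

section Independence

variable {n : ℕ} {r : Fin n → ℕ} [∀ i, NeZero (r i)]

theorem card_statIdx (r : Fin n → ℕ) [∀ i, NeZero (r i)] :
    Fintype.card (StatIdx r) = 1 + ∑ i, (r i - 1) := by
  simp [Fintype.card_subtype_compl, add_comm]

/-- Evaluation of a linear combination of the sufficient statistics. -/
theorem sum_mul_suffStat (v : StatIdx r → ℝ) (x : States r) :
    ∑ k, v k * suffStat r k x =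
      v none + ∑ i, if h : x i = 0 then 0 else v (some ⟨i, x i, h⟩) := by
  rw [Fintype.sum_option, Fintype.sum_sigma]
  congr 1
  · simp [suffStat]
  refine Finset.sum_congr rfl fun i _ => ?_
  split_ifs with h
  · refine Finset.sum_eq_zero fun a _ => ?_
    have : x i ≠ a := fun h' => a.2 (h' ▸ h)
    simp [suffStat, this]
  · rw [Finset.sum_eq_single ⟨x i, h⟩]
    · simp [suffStat]
    · intro a _ ha
      have : x i ≠ a := fun h' => ha (Subtype.ext h'.symm)
      simp [suffStat, this]
    · simp

/-- The span of the sufficient statistics of the independence model. -/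
def rowSpan (r : Fin n → ℕ) [∀ i, NeZero (r i)] : Submodule ℝ (States r → ℝ) :=
  Submodule.span ℝ (Set.range fun k x => suffStat r k x)

theorem const_mem_rowSpan (c : ℝ) : (fun _ => c) ∈ rowSpan r := by
  have : (fun _ : States r => c) = c • fun x => suffStat r none x := by
    ext x; simp [suffStat]
  rw [this]
  exact Submodule.smul_mem _ _ (Submodule.subset_span ⟨none, rfl⟩)

theorem comp_eval_mem_rowSpan (i : Fin n) (g : Fin (r i) → ℝ) :
    (fun x => g (x i)) ∈ rowSpan r := by
  have : (fun x : States r => g (x i)) = (fun _ => g 0) +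
      ∑ a : {a : Fin (r i) // a ≠ 0}, (g a - g 0) • fun x => suffStat r (some ⟨i, a⟩) x := by
    ext x
    simp only [suffStat, Matrix.of_apply, Pi.add_apply, Finset.sum_apply, Pi.smul_apply,
      smul_eq_mul, mul_ite, mul_one, mul_zero]
    by_cases h : x i = 0
    · rw [Finset.sum_eq_zero, h, add_zero]
      intro a _
      rw [if_neg]
      rw [h]
      exact a.2.symm
    · rw [Finset.sum_eq_single ⟨x i, h⟩]
      · simp
      · intro a _ ha
        rw [if_neg]
        exact fun h' => ha (Subtype.ext h'.symm)
      · simp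
  rw [this]
  exact Submodule.add_mem _ (const_mem_rowSpan _) (Submodule.sum_mem _ fun a _ =>
    Submodule.smul_mem _ _ (Submodule.subset_span ⟨_, rfl⟩))

theorem hammingDist_mem_rowSpan (c : States r) :
    (fun x => (hammingDist x c : ℝ)) ∈ rowSpan r := by
  have : (fun x : States r => (hammingDist x c : ℝ)) =
      ∑ i, fun x => (fun a => if a ≠ c i then (1 : ℝ) else 0) (x i) := by
    ext x
    simp only [hammingDist, Finset.card_filter, Finset.sum_apply]
    push_cast
    rfl
  rw [this]
  exact Submodule.sum_mem _ fun i _ =>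
    comp_eval_mem_rowSpan i fun a => if a ≠ c i then (1 : ℝ) else 0

/-- A linear combination of statistics that vanishes on two consecutive Hamming spheres vanishes,
if there is a point further away than the larger sphere. -/
theorem eq_zero_of_vanish_on_spheres (c z : States r) (t : ℕ) (hz : t + 1 < hammingDist z c)
    (v : StatIdx r → ℝ)
    (hv : ∀ x, hammingDist x c = t ∨ hammingDist x c = t + 1 →
      ∑ k, v k * suffStat r k x = 0) : v = 0 := by
  classical
  simp only [sum_mul_suffStat] at hv
  let g : (i : Fin n) → Fin (r i) → ℝ := fun i a =>
    if h : a = 0 then 0 else v (some ⟨i, a, h⟩)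
  have hv' : ∀ x, hammingDist x c = t ∨ hammingDist x c = t + 1 →
      v none + ∑ i, g i (x i) = 0 := hv
  -- `z` differs from `c` in at least `t + 2` places; copy `z` into `c` at `t` of them, avoiding
  -- `i`.
  have hsphere : ∀ i, ∃ x : States r, hammingDist x c = t ∧ x i = c i := by
    intro i
    have hcard : t ≤ ((Finset.univ.filter fun i => z i ≠ c i).erase i).card := by
      have := Finset.pred_card_le_card_erase (s := Finset.univ.filter fun i => z i ≠ c i) (a := i)
      rw [hammingDist] at hz
      omega
    obtain ⟨D, hD, hDt⟩ := Finset.exists_subset_card_eq hcard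
    refine ⟨D.piecewise z c, ?_, ?_⟩
    · rw [hammingDist, ← hDt]
      congr 1
      ext j
      by_cases hj : j ∈ D
      · have := hD hj
        simp_all
      · simp [hj]
    · have : i ∉ D := fun h => by simpa using hD h
      simp [this]
  -- Changing coordinate `i` of such an `x` to `a` moves from the inner sphere to the outer one;
  -- subtracting the two equations isolates coordinate `i`.
  have hg : ∀ i a, g i a = g i (c i) := by
    intro i a
    by_cases ha : a = c i
    · rw [ha]
    obtain ⟨x, hx, hxi⟩ := hsphere i
    have hx' : hammingDist (Function.update x i a) c = t + 1 := by
      rw [← hx, hammingDist, hammingDist, ← Finset.card_insert_of_notMem (a := i) (by simp [hxi])]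
      congr 1
      ext j
      by_cases hj : j = i
      · subst hj; simpa using ha
      · simp [hj]
    have h1 := hv' x (Or.inl hx)
    have h2 := hv' _ (Or.inr hx')
    rw [← Finset.add_sum_erase _ _ (Finset.mem_univ i)] at h1 h2
    have h3 : ∑ j ∈ Finset.univ.erase i, g j (Function.update x i a j) =
        ∑ j ∈ Finset.univ.erase i, g j (x j) :=
      Finset.sum_congr rfl fun j hj => by
        rw [Function.update_of_ne (Finset.ne_of_mem_erase hj)]
    rw [h3, Function.update_self] at h2
    rw [hxi] at h1
    linarith
  -- Each `g i` is constant and vanishes at the reference state `0`.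
  have hg0 : ∀ i a, g i a = 0 := fun i a => by
    rw [hg, ← hg i 0]
    simp [g]
  have hnone : v none = 0 := by
    obtain ⟨i, -⟩ : (Finset.univ.filter fun i => z i ≠ c i).Nonempty := by
      rw [← Finset.card_pos]
      rw [hammingDist] at hz
      omega
    obtain ⟨x, hx, -⟩ := hsphere i
    simpa [hg0] using hv' x (Or.inl hx)
  funext k
  rcases k with _ | ⟨i, a, ha⟩
  · exact hnone
  · simpa [g, ha] using hg0 i a

theorem IsFullRank.eq_zero {Z : Finset (States r)} (hZ : IsFullRank Z) (v : StatIdx r → ℝ)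
    (hv : ∀ x ∈ Z, ∑ k, v k * suffStat r k x = 0) : v = 0 := by
  have hli : LinearIndependent ℝ
      ((suffStat r).submatrix id (fun x : Z => (x : States r))).row := by
    rw [linearIndependent_iff_card_eq_finrank_span, Set.finrank, ← Matrix.rank_eq_finrank_span_row]
    exact hZ.symm
  have hinj := Matrix.vecMul_injective_iff.2 hli
  refine hinj ?_
  ext x
  simpa [Matrix.vecMul, dotProduct] using hv x x.2

theorem IsFullRank.nonempty {Z : Finset (States r)} (hZ : IsFullRank Z) : Z.Nonempty := by
  by_contra h
  rw [Finset.not_nonempty_iff_eq_empty] at h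
  subst h
  have := congrFun (hZ.eq_zero (fun _ => 1) (by simp)) none
  simp at this

/-- On a Hamming ball of radius one, the indicator function of every point is a combination of
the sufficient statistics. -/
theorem exists_mem_rowSpan_indicator (c z : States r) (hz : hammingDist z c ≤ 1) :
    ∃ f ∈ rowSpan r, ∀ x, hammingDist x c ≤ 1 → f x = if x = z then 1 else 0 := by
  classical
  by_cases hzc : z = c
  · subst hzc
    -- The centre is singled out by one minus the distance to it.
    refine ⟨_, Submodule.sub_mem _ (const_mem_rowSpan 1) (hammingDist_mem_rowSpan z), ?_⟩
    intro x hx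
    by_cases hxz : x = z
    · simp [hxz]
    · have h0 : hammingDist x z = 1 := le_antisymm hx (hammingDist_pos.2 hxz)
      simp [hxz, h0]
  · obtain ⟨i, hi⟩ := Function.ne_iff.1 hzc
    -- A point off the centre differs from it in a single coordinate `i`, whose value determines the
    -- point within the ball.
    refine ⟨_, comp_eval_mem_rowSpan i fun a => if a = z i then (1 : ℝ) else 0, ?_⟩
    have hun : ∀ x : States r, hammingDist x c ≤ 1 → x i ≠ c i → ∀ j, j ≠ i → x j = c j := by
      intro x hx hxi j hj
      by_contra hxj
      refine hj (Finset.card_le_one.1 hx j ?_ i ?_) <;> simpa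
    intro x hx
    refine if_congr ⟨fun h => ?_, fun h => h ▸ rfl⟩ rfl rfl
    funext j
    by_cases hj : j = i
    · rw [hj, h]
    · rw [hun x hx (h ▸ hi) j hj, hun z hz hi j hj]

end Independence

end DiscreteRBM

end

/-! ### Joint model and inference functions. -/

noncomputable section

namespace DiscreteRBM

open Module

variable {n m : ℕ} {r : Fin n → ℕ} {s : Fin m → ℕ} [∀ i, NeZero (r i)] [∀ j, NeZero (s j)]

/-- The span of the sufficient statistics of the joint model. -/
def jointSpan (r : Fin n → ℕ) (s : Fin m → ℕ) [∀ i, NeZero (r i)] [∀ j, NeZero (s j)] :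
    Submodule ℝ (States r × States s → ℝ) :=
  Submodule.span ℝ (Set.range fun k z => (suffStat r ⊗ₖ suffStat s) k z)

theorem mem_jointSpan {f : States r × States s → ℝ} :
    f ∈ jointSpan r s ↔
      ∃ θ : StatIdx r × StatIdx s → ℝ, ∀ z, ∑ k, θ k * (suffStat r ⊗ₖ suffStat s) k z = f z := by
  rw [jointSpan, Submodule.mem_span_range_iff_exists_fun]
  simp [funext_iff, Finset.sum_apply]

theorem mul_mem_jointSpan {f : States r → ℝ} {g : States s → ℝ} (hf : f ∈ rowSpan r)
    (hg : g ∈ rowSpan s) : (fun z => f z.1 * g z.2) ∈ jointSpan r s := by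
  obtain ⟨v, rfl⟩ := (Submodule.mem_span_range_iff_exists_fun ℝ).1 hf
  obtain ⟨w, rfl⟩ := (Submodule.mem_span_range_iff_exists_fun ℝ).1 hg
  refine mem_jointSpan.2 ⟨fun k => v k.1 * w k.2, fun z => ?_⟩
  simp only [Finset.sum_apply, Pi.smul_apply, smul_eq_mul, Fintype.sum_prod_type,
    Finset.sum_mul_sum, Matrix.kroneckerMap_apply]
  exact Finset.sum_congr rfl fun _ _ => Finset.sum_congr rfl fun _ _ => by ring

/-- Such scores are realized by a parameter `θ`. Being a sum over hidden units, the score is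
maximized unit by unit. -/
theorem sum_scores_mem_jointSpan (W : (j : Fin m) → Fin (s j) → States r → ℝ)
    (hW : ∀ j b, W j b ∈ rowSpan r) :
    (fun z : States r × States s => ∑ j, W j (z.2 j) z.1) ∈ jointSpan r s := by
  have : (fun z : States r × States s => ∑ j, W j (z.2 j) z.1) =
      ∑ j, ∑ b, fun z => W j b z.1 * (fun y : States s => if y j = b then (1 : ℝ) else 0) z.2 := by
    ext z
    simp [Finset.sum_apply]
  rw [this]
  exact Submodule.sum_mem _ fun j _ => Submodule.sum_mem _ fun b _ =>
    mul_mem_jointSpan (hW j b) (comp_eval_mem_rowSpan j fun a => if a = b then (1 : ℝ) else 0)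

/-- The statistics of the joint model selected by an inference function `h`. -/
def inferenceMatrix (h : States r → States s) : Matrix (States r) (StatIdx r × StatIdx s) ℝ :=
  Matrix.of fun x k => (suffStat r ⊗ₖ suffStat s) k (x, h x)

theorem inferenceMatrix_mulVec (h : States r → States s) (v : StatIdx r × StatIdx s → ℝ)
    (x : States r) :
    (inferenceMatrix h).mulVec v x = ∑ k, v (k, none) * suffStat r k x +
      ∑ j, if hj : h x j = 0 then 0 else ∑ k, v (k, some ⟨j, h x j, hj⟩) * suffStat r k x := by
  rw [← sum_mul_suffStat (fun q => ∑ k, v (k, q) * suffStat r k x) (h x)]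
  simp only [Matrix.mulVec, dotProduct, inferenceMatrix, Matrix.of_apply, Fintype.sum_prod_type,
    Matrix.kroneckerMap_apply, Finset.sum_mul]
  rw [Finset.sum_comm]
  exact Finset.sum_congr rfl fun _ _ => Finset.sum_congr rfl fun _ _ => by ring

theorem RBM_eq_range (r : Fin n → ℕ) (s : Fin m → ℕ) [∀ i, NeZero (r i)] [∀ j, NeZero (s j)] :
    RBM r s = Set.range fun (θ : StatIdx r × StatIdx s → ℝ) (x : States r) =>
      (∑ y, Real.exp (∑ k, θ k * (suffStat r ⊗ₖ suffStat s) k (x, y))) /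
        ∑ x, ∑ y, Real.exp (∑ k, θ k * (suffStat r ⊗ₖ suffStat s) k (x, y)) := by
  rw [RBM, jointModel, expFamily, ← Set.range_comp]
  congr 1
  ext θ x
  simp only [Function.comp, ← Finset.sum_div, Fintype.sum_prod_type (α₁ := States r)]

/-- If hidden states are inferred uniquely by maximizing scores in the span of the statistics, the
rank of the selected statistics bounds the dimension of the machine from below. -/
theorem rank_inferenceMatrix_le_dimH_RBM (W : (j : Fin m) → Fin (s j) → States r → ℝ)
    (hW : ∀ j b, W j b ∈ rowSpan r) (h : States r → States s)
    (hh : ∀ x j b, b ≠ h x j → W j b x < W j (h x j) x) {K : ℕ}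
    (hK : K ≤ (inferenceMatrix h).rank) : ((K - 1 : ℕ) : ENNReal) ≤ dimH (RBM r s) := by
  obtain ⟨θ, hθ⟩ := mem_jointSpan.1 (sum_scores_mem_jointSpan W hW)
  let a : States r → States s → (StatIdx r × StatIdx s → ℝ) →L[ℝ] ℝ := fun x y =>
    ∑ k, (suffStat r ⊗ₖ suffStat s) k (x, y) •
      ContinuousLinearMap.proj (R := ℝ) (φ := fun _ => ℝ) k
  have ha : ∀ x y v, a x y v = ∑ k, v k * (suffStat r ⊗ₖ suffStat s) k (x, y) := by
    intro x y v
    simp only [a, sum_apply, smul_apply,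
      ContinuousLinearMap.proj_apply, smul_eq_mul, mul_comm]
  have hL : (ContinuousLinearMap.pi fun x => a x (h x) :
      (StatIdx r × StatIdx s → ℝ) →L[ℝ] (States r → ℝ)).toLinearMap =
        (inferenceMatrix h).mulVecLin := by
    ext1 k
    ext : 2
    simp [ha, inferenceMatrix, Matrix.mulVec, dotProduct, mul_comm]
  have := finrank_inference_le_dimH_marginal a θ h (fun x y hy => by
    rw [ha, ha, hθ, hθ]
    obtain ⟨j, hj⟩ := Function.ne_iff.1 hy
    refine Finset.sum_lt_sum (fun j _ => ?_) ⟨j, Finset.mem_univ _, hh x j _ hj⟩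
    by_cases hj : y j = h x j
    · simp [hj]
    · exact (hh x j _ hj).le) K (by rw [hL]; exact hK)
  simpa only [RBM_eq_range, ha] using this

theorem sum_eq_one_of_mem_RBM {p : States r → ℝ} (hp : p ∈ RBM r s) : ∑ x, p x = 1 := by
  rw [RBM_eq_range] at hp
  obtain ⟨θ, rfl⟩ := hp
  simp only [← Finset.sum_div]
  refine div_self (Finset.sum_pos (fun x _ => ?_) Finset.univ_nonempty).ne'
  exact Finset.sum_pos (fun _ _ => Real.exp_pos _) Finset.univ_nonempty

theorem dimH_RBM_le_card_states (r : Fin n → ℕ) (s : Fin m → ℕ) [∀ i, NeZero (r i)]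
    [∀ j, NeZero (s j)] :
    dimH (RBM r s) ≤ ((Fintype.card (States r) - 1 : ℕ) : ENNReal) :=
  dimH_le_of_sum_eq_one fun _ hp => sum_eq_one_of_mem_RBM hp

theorem dimH_RBM_le_dimH_jointModel (r : Fin n → ℕ) (s : Fin m → ℕ) [∀ i, NeZero (r i)]
    [∀ j, NeZero (s j)] : dimH (RBM r s) ≤ dimH (jointModel r s) := by
  let L : (States r × States s → ℝ) →L[ℝ] (States r → ℝ) := ContinuousLinearMap.pi fun x =>
    ∑ y, ContinuousLinearMap.proj (R := ℝ) (φ := fun _ : States r × States s => ℝ) (x, y)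
  have : RBM r s = L '' jointModel r s := by
    rw [RBM]
    refine Set.image_congr fun p _ => ?_
    ext x
    simp [L]
  rw [this]
  exact L.lipschitz.dimH_image_le _

theorem dimH_jointModel_le (r : Fin n → ℕ) (s : Fin m → ℕ) [∀ i, NeZero (r i)]
    [∀ j, NeZero (s j)] :
    dimH (jointModel r s) ≤
      (((1 + ∑ i, (r i - 1)) * (1 + ∑ j, (s j - 1)) - 1 : ℕ) : ENNReal) := by
  have := dimH_expFamily_le (suffStat r ⊗ₖ suffStat s) (none, none) (by simp [suffStat])
  rwa [Fintype.card_prod, card_statIdx, card_statIdx] at this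

/-! ### Disjoint balls: the expected dimension. -/

/-- The score `l ↦ l (d - 1/2) - l²` on `{0, …, k}` has the unique maximizer `min (d / 2) k`. -/
theorem score_lt_score (d k l : ℕ) (hl : l ≤ k) (hne : l ≠ min (d / 2) k) :
    (l : ℝ) * (d - 1 / 2) - l ^ 2 <
      (min (d / 2) k : ℕ) * ((d : ℝ) - 1 / 2) - (min (d / 2) k : ℕ) ^ 2 := by
  obtain ⟨q, hq⟩ : ∃ q, min (d / 2) k = q := ⟨_, rfl⟩
  rw [hq] at hne ⊢
  -- The score gap between `q` and `l` is `(q - l) * (d - 1/2 - l - q)`; the `1/2` excludes ties at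
  -- integers.
  rcases lt_or_gt_of_ne hne with h | h
  · have h1 : l + q + 1 ≤ d := by omega
    have h1' : (l : ℝ) + q + 1 ≤ d := by exact_mod_cast h1
    have h2 : (l : ℝ) < q := by exact_mod_cast h
    nlinarith [mul_pos (sub_pos.2 h2) (show (0 : ℝ) < d - 1 / 2 - l - q by linarith)]
  · have h1 : d ≤ l + q := by omega
    have h1' : (d : ℝ) ≤ l + q := by exact_mod_cast h1
    have h2 : (q : ℝ) < l := by exact_mod_cast h
    nlinarith [mul_pos (sub_pos.2 h2) (show (0 : ℝ) < l + q - (d - 1 / 2) by linarith)]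

theorem mem_hammingBall_sub_one {n : ℕ} {r : Fin n → ℕ} {c x : States r} {q : ℕ} [NeZero q] :
    x ∈ hammingBall c (2 * ((q : ℤ) - 1) - 1) ↔ hammingDist x c < 2 * (q - 1) := by
  have := NeZero.pos q
  simp only [hammingBall, Finset.mem_filter, Finset.mem_univ, true_and]
  omega

/-- Disjoint Hamming balls whose complement has full rank give the expected dimension. -/
theorem params_le_dimH_RBM (c : Fin m → States r)
    (hdisj : ∀ j j' : Fin m, j ≠ j' →
      Disjoint (hammingBall (c j) (2 * ((s j : ℤ) - 1) - 1))
        (hammingBall (c j') (2 * ((s j' : ℤ) - 1) - 1)))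
    (hfull : IsFullRank (Finset.univ.biUnion fun j : Fin m =>
      hammingBall (c j) (2 * ((s j : ℤ) - 1) - 1))ᶜ) :
    (((1 + ∑ i, (r i - 1)) * (1 + ∑ j, (s j - 1)) - 1 : ℕ) : ENNReal) ≤ dimH (RBM r s) := by
  have hs : ∀ j, 0 < s j := fun j => NeZero.pos (s j)
  -- State `b` is scored with `l = s j - 1 - b`, so it wins at distances `2 * l` and `2 * l + 1`
  -- when `b ≠ 0`, and state `0` wins at all distances from `2 * (s j - 1)` on.
  let W : (j : Fin m) → Fin (s j) → States r → ℝ := fun j b x =>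
    ((s j - 1 - b : ℕ) : ℝ) * (hammingDist x (c j) - 1 / 2) - ((s j - 1 - b : ℕ) : ℝ) ^ 2
  let h : States r → States s := fun x j =>
    ⟨s j - 1 - min (hammingDist x (c j) / 2) (s j - 1), by have := hs j; omega⟩
  have hval : ∀ x j, (h x j : ℕ) = s j - 1 - min (hammingDist x (c j) / 2) (s j - 1) :=
    fun _ _ => rfl
  have hzero : ∀ x j, h x j = 0 ↔ 2 * (s j - 1) ≤ hammingDist x (c j) := by
    intro x j
    rw [Fin.ext_iff, hval, Fin.val_zero]
    omega
  have hW : ∀ j b, W j b ∈ rowSpan r := fun j b =>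
    Submodule.sub_mem _ (Submodule.smul_mem _ ((s j - 1 - b : ℕ) : ℝ)
      (Submodule.sub_mem _ (hammingDist_mem_rowSpan (c j)) (const_mem_rowSpan (1 / 2))))
      (const_mem_rowSpan _)
  have hh : ∀ x j b, b ≠ h x j → W j b x < W j (h x j) x := by
    intro x j b hb
    have hb' : (b : ℕ) ≠ h x j := fun hb' => hb (Fin.ext hb')
    have hbs := b.2
    rw [hval] at hb'
    have hsub : s j - 1 - (h x j : ℕ) = min (hammingDist x (c j) / 2) (s j - 1) := by
      rw [hval]; omega
    simp only [W, hsub]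
    exact score_lt_score _ _ _ (by omega) (by omega)
  have hinj : Function.Injective (inferenceMatrix h).mulVecLin := by
    rw [← LinearMap.ker_eq_bot, LinearMap.ker_eq_bot']
    intro v hv
    have hv' : ∀ x, ∑ k, v (k, none) * suffStat r k x + (∑ j, if hj : h x j = 0 then 0 else
        ∑ k, v (k, some ⟨j, h x j, hj⟩) * suffStat r k x) = 0 := fun x => by
      rw [← inferenceMatrix_mulVec]
      exact congrFun hv x
    have hout : ∀ x ∈ (Finset.univ.biUnion fun j : Fin m =>
        hammingBall (c j) (2 * ((s j : ℤ) - 1) - 1))ᶜ,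
        ∀ j, 2 * (s j - 1) ≤ hammingDist x (c j) := by
      intro x hx j
      by_contra hlt
      refine Finset.mem_compl.1 hx (Finset.mem_biUnion.2 ⟨j, Finset.mem_univ _, ?_⟩)
      exact mem_hammingBall_sub_one.2 (not_le.1 hlt)
    -- Off the balls every hidden unit is in state `0`, so only the constant block is seen.
    have hv0 : (fun k => v (k, none)) = 0 := by
      refine hfull.eq_zero _ fun x hx => ?_
      refine Eq.trans (left_eq_add.2 (Finset.sum_eq_zero fun j _ => ?_)) (hv' x)
      rw [dif_pos ((hzero x j).2 (hout x hx j))]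
    obtain ⟨z, hz⟩ := hfull.nonempty
    have hvj : ∀ j (b : Fin (s j)) (hb : b ≠ 0), (fun k => v (k, some ⟨j, b, hb⟩)) = 0 := by
      intro j b hb
      have hb0 : 0 < (b : ℕ) := Fin.pos_iff_ne_zero.2 hb
      have hbs := b.2
      have hzj := hout z hz j
      -- The two spheres where unit `j` takes state `b` lie in ball `j`, since `b ≥ 1`. By
      -- disjointness all other units are `0` there, and `z`, outside the balls, is further away.
      refine eq_zero_of_vanish_on_spheres (c j) z (2 * (s j - 1 - b)) (by omega) _ fun x hx => ?_
      have hxj : h x j = b := by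
        rw [Fin.ext_iff, hval]
        omega
      have hxball : x ∈ hammingBall (c j) (2 * ((s j : ℤ) - 1) - 1) :=
        mem_hammingBall_sub_one.2 (by omega)
      have hx0 : ∀ j', j' ≠ j → h x j' = 0 := by
        intro j' hj'
        rw [hzero]
        by_contra hlt
        exact Finset.disjoint_left.1 (hdisj j j' hj'.symm) hxball
          (mem_hammingBall_sub_one.2 (not_le.1 hlt))
      have := hv' x
      rw [Finset.sum_eq_single j (fun j' _ hj' => by rw [dif_pos (hx0 j' hj')]) (by simp),
        dif_neg (hxj ▸ hb)] at this
      simpa only [congrFun hv0 _, Pi.zero_apply, zero_mul, Finset.sum_const_zero, zero_add,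
        hxj] using this
    funext ⟨k, q⟩
    rcases q with _ | ⟨j, b, hb⟩
    · exact congrFun hv0 k
    · exact congrFun (hvj j b hb) k
  have hrank : (inferenceMatrix h).rank = (1 + ∑ i, (r i - 1)) * (1 + ∑ j, (s j - 1)) := by
    rw [Matrix.rank, LinearMap.finrank_range_of_inj hinj, finrank_pi, Fintype.card_prod,
      card_statIdx, card_statIdx]
  exact rank_inferenceMatrix_le_dimH_RBM W hW h hh hrank.ge

/-! ### Covering balls: full dimension. -/

/-- Hamming balls of radius one that cover the state space give full dimension. -/
theorem card_states_le_dimH_RBM (hs : ∀ j, 2 ≤ s j) (c : Fin m → States r)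
    (hcover : (Finset.univ.biUnion fun j : Fin m => hammingBall (c j) 1) = Finset.univ) :
    ((Fintype.card (States r) - 1 : ℕ) : ENNReal) ≤ dimH (RBM r s) := by
  classical
  let one : (j : Fin m) → Fin (s j) := fun j => ⟨1, hs j⟩
  have hone : ∀ j, one j ≠ 0 := fun j => by simp [one, Fin.ext_iff]
  -- The threshold `3 / 2` separates distances at most one from those at least two; the score `-1`
  -- keeps the remaining states from ever winning.
  let W : (j : Fin m) → Fin (s j) → States r → ℝ := fun j b =>
    if b = 0 then fun _ => 0 else
      if b = one j then (fun _ => 3 / 2) - fun x => (hammingDist x (c j) : ℝ) else fun _ => -1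
  let h : States r → States s := fun x j => if hammingDist x (c j) ≤ 1 then one j else 0
  have hW : ∀ j b, W j b ∈ rowSpan r := by
    intro j b
    simp only [W]
    split_ifs
    · exact const_mem_rowSpan 0
    · exact Submodule.sub_mem _ (const_mem_rowSpan _) (hammingDist_mem_rowSpan _)
    · exact const_mem_rowSpan (-1)
  have hh : ∀ x j b, b ≠ h x j → W j b x < W j (h x j) x := by
    intro x j b hb
    by_cases hd : hammingDist x (c j) ≤ 1
    · have hd' : (hammingDist x (c j) : ℝ) ≤ 1 := by exact_mod_cast hd
      simp only [h, hd, if_true] at hb ⊢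
      by_cases hb0 : b = 0
      · simp [W, hone, hb0]; linarith
      · simp [W, hone, hb0, hb]; linarith
    · have hd' : (2 : ℝ) ≤ hammingDist x (c j) := by exact_mod_cast not_le.1 hd
      simp only [h, hd, if_false] at hb ⊢
      by_cases hb1 : b = one j
      · simp [W, hone, hb1]; linarith
      · simp [W, hb, hb1]
  have hsingle : ∀ z, Pi.single z 1 ∈ LinearMap.range (inferenceMatrix h).mulVecLin := by
    intro z
    obtain ⟨j, -, hj⟩ := Finset.mem_biUnion.1 (hcover ▸ Finset.mem_univ z)
    have hzj : hammingDist z (c j) ≤ 1 := by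
      simpa [hammingBall] using hj
    obtain ⟨f, hf, hfz⟩ := exists_mem_rowSpan_indicator (c j) z hzj
    -- Evaluated at `y = h x`, the factor testing `y j = one j` cuts `f` off outside ball `j`,
    -- leaving the indicator of `z` on the whole space.
    obtain ⟨v, hv⟩ := mem_jointSpan.1 (mul_mem_jointSpan hf
      (comp_eval_mem_rowSpan (r := s) j fun a => if a = one j then (1 : ℝ) else 0))
    refine ⟨v, ?_⟩
    ext x
    have hvx := hv (x, h x)
    simp only [Matrix.mulVecLin_apply, Matrix.mulVec, dotProduct, inferenceMatrix,
      Matrix.of_apply]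
    simp only [mul_comm (v _)] at hvx
    rw [hvx, Pi.single_apply]
    by_cases hd : hammingDist x (c j) ≤ 1
    · simp [h, hd, hfz x hd]
    · have hxz : x ≠ z := fun hxz => hd (hxz ▸ hzj)
      simp [h, hd, hxz, (hone j).symm]
  have hrank : (inferenceMatrix h).rank = Fintype.card (States r) := by
    have htop : LinearMap.range (inferenceMatrix h).mulVecLin = ⊤ := by
      rw [eq_top_iff]
      rintro u -
      rw [pi_eq_sum_univ' u]
      refine Submodule.sum_mem _ fun z _ => ?_
      convert Submodule.smul_mem _ (u z) (hsingle z) using 2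
    rw [Matrix.rank, htop, finrank_top, finrank_pi]
  exact rank_inferenceMatrix_le_dimH_RBM W hW h hh hrank.ge

end DiscreteRBM

end

theorem mainTheorem3 {n m : ℕ} (r : Fin n → ℕ) (s : Fin m → ℕ)
    [∀ i, NeZero (r i)] [∀ j, NeZero (s j)] :
    -- Disjoint balls whose complement has full rank: the dimension is the number of free
    -- parameters, and it is the dimension expected from counting parameters.
    (∀ c : Fin m → DiscreteRBM.States r,
      (∀ j j' : Fin m, j ≠ j' →
        Disjoint (DiscreteRBM.hammingBall (c j) (2 * ((s j : ℤ) - 1) - 1))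
          (DiscreteRBM.hammingBall (c j') (2 * ((s j' : ℤ) - 1) - 1))) →
      DiscreteRBM.IsFullRank
        (Finset.univ.biUnion fun j : Fin m =>
          DiscreteRBM.hammingBall (c j) (2 * ((s j : ℤ) - 1) - 1))ᶜ →
      dimH (DiscreteRBM.RBM r s) =
          (((1 + ∑ i, (r i - 1)) * (1 + ∑ j, (s j - 1)) - 1 : ℕ) : ENNReal) ∧
        dimH (DiscreteRBM.RBM r s) =
          min (dimH (DiscreteRBM.jointModel r s))
            ((Fintype.card (DiscreteRBM.States r) - 1 : ℕ) : ENNReal)) ∧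
    -- Balls of radius one that cover the visible state space: the model is full-dimensional.
    ((∀ j, 2 ≤ s j) →
      ∀ c : Fin m → DiscreteRBM.States r,
        (Finset.univ.biUnion fun j : Fin m => DiscreteRBM.hammingBall (c j) 1) = Finset.univ →
        dimH (DiscreteRBM.RBM r s) =
          ((Fintype.card (DiscreteRBM.States r) - 1 : ℕ) : ENNReal)) := by
  refine ⟨fun c hdisj hfull => ?_, fun hs c hcover => ?_⟩
  · have hdim := le_antisymm ((DiscreteRBM.dimH_RBM_le_dimH_jointModel r s).trans
      (DiscreteRBM.dimH_jointModel_le r s)) (DiscreteRBM.params_le_dimH_RBM c hdisj hfull)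
    refine ⟨hdim, le_antisymm (le_min (DiscreteRBM.dimH_RBM_le_dimH_jointModel r s)
      (DiscreteRBM.dimH_RBM_le_card_states r s)) ((min_le_left _ _).trans ?_)⟩
    rw [hdim]
    exact DiscreteRBM.dimH_jointModel_le r s
  · exact le_antisymm (DiscreteRBM.dimH_RBM_le_card_states r s)
      (DiscreteRBM.card_states_le_dimH_RBM hs c hcover)
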